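/- Let $n\geq 3$. The degree sequence of a simple graph $G$ on the vertex set $[n]=\{1,\ldots,n\}$ is the vector $(d_1,\ldots,d_n)\in\mathbb{R}^n$, where $d_j$ is the degree of the vertex $j$ in $G$; the degree partition of $G$ is its degree sequence rearranged in weakly decreasing order. Let $\mathsf{DS}(n)\subseteq\mathbb{R}^n$ be the convex hull of all degree sequences, and $\mathsf{DP}(n)\subseteq\mathbb{R}^n$ the convex hull of all degree partitions, of simple graphs on $[n]$. Then $$\operatorname{vol}(\mathsf{DS}(n)) = n!\cdot\operatorname{vol}(\mathsf{DP}(n)),$$ where $\operatorname{vol}$ is the $n$-dimensional Lebesgue measure. Moreover, $\mathsf{DP}(n)$ is the asymmetric part of $\mathsf{DS}(n)$, both in terms of linear inequalities and in terms of lattice points: $$\mathsf{DP}(n)=\{x\in\mathsf{DS}(n) : x_1\geq x_2\geq\cdots\geq x_n\}=\operatorname{conv}\{x\in\mathsf{DS}(n)\cap\mathbb{N}^n : x_1\geq x_2\geq\cdots\geq x_n\}$$ (with $0\in\mathbb{N}$), and both polytopes are full-dimensional: $\dim\mathsf{DS}(n)=\dim\mathsf{DP}(n)=n$. -/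

import Mathlib

namespace DegreePolytopes

/-- The degree sequence of a simple graph on `n` labelled vertices, as a vector in `ℝⁿ`. -/
noncomputable def degreeSequence {n : ℕ} (G : SimpleGraph (Fin n)) : Fin n → ℝ :=
  open scoped Classical in fun i => (G.degree i : ℝ)

/-- The set of all degree sequences of simple graphs on `n` labelled vertices. -/
def degreeSequences (n : ℕ) : Set (Fin n → ℝ) :=
  {d | ∃ G : SimpleGraph (Fin n), d = degreeSequence G}

/-- The set of all degree partitions: the weakly decreasing rearrangements of degree sequences. -/
def degreePartitions (n : ℕ) : Set (Fin n → ℝ) :=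
  {d | Antitone d ∧
    ∃ (G : SimpleGraph (Fin n)) (σ : Equiv.Perm (Fin n)), d = degreeSequence G ∘ σ}

/-- The polytope of degree sequences. -/
def DS (n : ℕ) : Set (Fin n → ℝ) := convexHull ℝ (degreeSequences n)

/-- The polytope of degree partitions. -/
def DP (n : ℕ) : Set (Fin n → ℝ) := convexHull ℝ (degreePartitions n)

/-- The asymmetric part of `P` in terms of linear inequalities: the inequalities
`x₁ ≥ x₂ ≥ ⋯ ≥ xₙ` are added to those that define `P`. -/
def asymmetricPart {n : ℕ} (P : Set (Fin n → ℝ)) : Set (Fin n → ℝ) :=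
  {x | x ∈ P ∧ Antitone x}

/-- The asymmetric part of `P` in terms of lattice points: the convex hull of the weakly
decreasing points of `P` with natural number coordinates. -/
def latticeAsymmetricPart {n : ℕ} (P : Set (Fin n → ℝ)) : Set (Fin n → ℝ) :=
  convexHull ℝ {x | x ∈ P ∧ (∃ m : Fin n → ℕ, x = fun i => (m i : ℝ)) ∧ Antitone x}

/-- The dimension of a (nonempty) convex set in `ℝⁿ`: the dimension of its affine hull. -/
noncomputable def dim {n : ℕ} (P : Set (Fin n → ℝ)) : ℕ :=
  Module.finrank ℝ (affineSpan ℝ P).direction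

end DegreePolytopes

/-!
A linear functional `c` is maximized over all degree sequences by the threshold graph with weights
`c`, since the value of `c` at a degree sequence is the sum of `c i + c j` over the edges. To
maximize `c` over the weakly decreasing vectors of `DS n`, project `c` to the nearest point `p` of
the cone of weakly decreasing vectors. The threshold graph of `p` has a weakly decreasing degree
sequence `d`, which is constant wherever `p` is, so that `d` is orthogonal to `c - p` and maximizes
`c` as well as `p`. Hence `d` is a maximizer lying in `DP n`, and separating hyperplanes give
`asymmetricPart (DS n) ⊆ DP n`.

The cone is also a fundamental domain for the permutations of the coordinates, which preserve
`DS n`; this gives the volume identity. A convex set is full-dimensional if and only if its volume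
is nonzero, so full-dimensionality passes from `DS n` to `DP n`.
-/

namespace DegreePolytopes

open MeasureTheory
open scoped Matrix Pointwise RealInnerProductSpace

section Cones

theorem exists_polar_decomposition {E : Type*} [NormedAddCommGroup E] [InnerProductSpace ℝ E]
    [CompleteSpace E] (C : ProperCone ℝ E) (c : E) :
    ∃ p ∈ C, ⟪c - p, p⟫ = 0 ∧ ∀ w ∈ C, ⟪c - p, w⟫ ≤ 0 := by
  obtain ⟨p, hp, hmin⟩ := exists_norm_eq_iInf_of_complete_convex C.nonempty
    C.isClosed.isComplete C.convex c
  have hvar : ∀ w ∈ C, ⟪c - p, w - p⟫ ≤ 0 :=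
    (norm_eq_iInf_iff_real_inner_le_zero C.convex hp).1 hmin
  have hpolar : ∀ w ∈ C, ⟪c - p, w⟫ ≤ 0 := fun w hw => by
    simpa using hvar (w + p) (add_mem hw hp)
  have hnonneg : 0 ≤ ⟪c - p, p⟫ := by simpa using hvar 0 (zero_mem C)
  exact ⟨p, hp, (hpolar p hp).antisymm hnonneg, hpolar⟩

theorem exists_polar_decomposition_dotProduct {ι : Type*} [Fintype ι]
    (C : ProperCone ℝ (ι → ℝ)) (c : ι → ℝ) :
    ∃ p ∈ C, (c - p) ⬝ᵥ p = 0 ∧ ∀ w ∈ C, (c - p) ⬝ᵥ w ≤ 0 := by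
  obtain ⟨p, hp, horth, hpolar⟩ := exists_polar_decomposition
    (C.comap (EuclideanSpace.equiv ι ℝ : EuclideanSpace ℝ ι →L[ℝ] ι → ℝ)) (WithLp.toLp 2 c)
  simp only [EuclideanSpace.inner_eq_star_dotProduct, star_trivial] at horth hpolar
  exact ⟨p.ofLp, hp, (dotProduct_comm _ _).trans horth,
    fun w hw => (dotProduct_comm _ _).trans_le (hpolar (WithLp.toLp 2 w) hw)⟩

theorem mem_of_forall_exists_dotProduct_le {ι : Type*} [Fintype ι] {P : Set (ι → ℝ)}
    (hconv : Convex ℝ P) (hclosed : IsClosed P) {x : ι → ℝ}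
    (h : ∀ c : ι → ℝ, ∃ d ∈ P, c ⬝ᵥ x ≤ c ⬝ᵥ d) : x ∈ P := by
  classical
  rw [← iInter_halfSpaces_eq hconv hclosed]
  refine Set.mem_iInter.2 fun f => ?_
  obtain ⟨c, hc⟩ := (dotProductEquiv ℝ ι).surjective f.toLinearMap
  have hf : ∀ y, f y = c ⬝ᵥ y := fun y => (LinearMap.congr_fun hc y).symm
  obtain ⟨d, hd, hle⟩ := h c
  exact ⟨d, hd, by rwa [hf, hf]⟩

theorem dotProduct_le_of_mem_convexHull {ι : Type*} [Fintype ι] {S : Set (ι → ℝ)} {c x : ι → ℝ}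
    {b : ℝ} (hS : ∀ y ∈ S, c ⬝ᵥ y ≤ b) (hx : x ∈ convexHull ℝ S) : c ⬝ᵥ x ≤ b :=
  convexHull_min hS
    (convex_halfSpace_le ⟨dotProduct_add c, fun a y => dotProduct_smul a c y⟩ b) hx

/-- The vector `p` is to be thought of as the projection of a functional `c` to `C`. The condition
`p - ε • d ∈ C` then gives `(c - p) ⬝ᵥ d = 0`, so that `d` maximizes `c` on the intersection. -/
theorem convexHull_inter_properCone {ι : Type*} [Fintype ι] {S : Set (ι → ℝ)}
    {C : ProperCone ℝ (ι → ℝ)} (hclosed : IsClosed (convexHull ℝ (S ∩ C)))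
    (h : ∀ p ∈ C, ∃ d ∈ S ∩ C, (∀ x ∈ S, p ⬝ᵥ x ≤ p ⬝ᵥ d) ∧ ∃ ε > (0 : ℝ), p - ε • d ∈ C) :
    convexHull ℝ S ∩ C = convexHull ℝ (S ∩ C) := by
  refine Set.Subset.antisymm (fun x ⟨hxS, hxC⟩ => ?_) (convexHull_min ?_ ?_)
  · refine mem_of_forall_exists_dotProduct_le (convex_convexHull ℝ _) hclosed fun c => ?_
    obtain ⟨p, hp, horth, hpolar⟩ := exists_polar_decomposition_dotProduct C c
    obtain ⟨d, hd, hmax, ε, hε, hface⟩ := h p hp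
    have hpx : p ⬝ᵥ x ≤ p ⬝ᵥ d := dotProduct_le_of_mem_convexHull hmax hxS
    have hqx : (c - p) ⬝ᵥ x ≤ 0 := hpolar x hxC
    have hqd : 0 ≤ (c - p) ⬝ᵥ d := by
      have hεd := hpolar _ hface
      rw [dotProduct_sub, horth, zero_sub, dotProduct_smul, smul_eq_mul, neg_nonpos] at hεd
      exact nonneg_of_mul_nonneg_right hεd hε
    rw [sub_dotProduct] at hqx hqd
    exact ⟨d, subset_convexHull ℝ _ hd, by linarith⟩
  · exact Set.inter_subset_inter_left _ (subset_convexHull ℝ S)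
  · exact (convex_convexHull ℝ S).inter C.convex

/-- The closed convex cone of weakly decreasing vectors, onto which linear functionals are
projected. -/
def antitoneCone (ι : Type*) [Preorder ι] : ProperCone ℝ (ι → ℝ) where
  carrier := {x | Antitone x}
  add_mem' hx hy := hx.add hy
  zero_mem' := antitone_const
  smul_mem' a _ hx := hx.const_smul a.2
  isClosed' := isClosed_antitone

theorem exists_pos_sub_smul_mem_antitoneCone {ι : Type*} [Finite ι] [Preorder ι] {p d : ι → ℝ}
    (hp : p ∈ antitoneCone ι) (hd : ∀ i j, p i = p j → d i = d j) :
    ∃ ε > (0 : ℝ), p - ε • d ∈ antitoneCone ι := by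
  have hpair : ∀ i j, i ≤ j → ∀ᶠ ε in nhdsWithin (0 : ℝ) (Set.Ioi 0),
      (p - ε • d) j ≤ (p - ε • d) i := by
    intro i j hij
    rcases (hp hij).eq_or_lt with heq | hlt
    · simp [heq, hd j i heq]
    · have hleft : Continuous fun ε : ℝ => (p - ε • d) j := by fun_prop
      have hright : Continuous fun ε : ℝ => (p - ε • d) i := by fun_prop
      have hstrict : ∀ᶠ ε in nhds (0 : ℝ), (p - ε • d) j < (p - ε • d) i :=
        hleft.continuousAt.eventually_lt hright.continuousAt (by simpa using hlt)
      exact nhdsWithin_le_nhds (hstrict.mono fun _ => le_of_lt)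
  have hall : ∀ᶠ ε in nhdsWithin (0 : ℝ) (Set.Ioi 0), p - ε • d ∈ antitoneCone ι :=
    Filter.eventually_all.2 fun i => Filter.eventually_all.2 fun j =>
      Filter.eventually_imp_distrib_left.2 (hpair i j)
  obtain ⟨ε, hmem, hpos⟩ := (hall.and self_mem_nhdsWithin).exists
  exact ⟨ε, hpos, hmem⟩

end Cones

section ThresholdGraphs

variable {V R : Type*}

/-- The threshold graph with vertex weights `c`: distinct vertices are adjacent when the sum of
their weights is positive. Its edges are exactly those that help to maximize the functional `c` on
degree sequences. -/
def thresholdGraph [AddCommMonoid R] [LT R] (c : V → R) : SimpleGraph V where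
  Adj i j := i ≠ j ∧ 0 < c i + c j
  symm := ⟨fun i j h => ⟨h.1.symm, add_comm (c i) (c j) ▸ h.2⟩⟩
  loopless := ⟨fun _ h => h.1 rfl⟩

theorem degree_thresholdGraph_le_of_le [AddCommMonoid R] [Preorder R] [IsOrderedAddMonoid R]
    {c : V → R} {i j : V} [Fintype ((thresholdGraph c).neighborSet i)]
    [Fintype ((thresholdGraph c).neighborSet j)] (h : c j ≤ c i) :
    (thresholdGraph c).degree j ≤ (thresholdGraph c).degree i := by
  classical
  refine Finset.card_le_card_of_injOn (Equiv.swap i j) (fun k hk => ?_)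
    (Equiv.swap i j).injective.injOn
  rw [Finset.mem_coe, SimpleGraph.mem_neighborFinset] at hk ⊢
  rcases eq_or_ne k i with rfl | hki
  · rw [Equiv.swap_apply_left]
    exact hk.symm
  · rw [Equiv.swap_apply_of_ne_of_ne hki hk.1.symm]
    exact ⟨hki.symm, hk.2.trans_le (by gcongr)⟩

variable [Fintype V]

theorem two_mul_dotProduct_degree [NonAssocSemiring R] (c : V → R) (G : SimpleGraph V)
    [DecidableRel G.Adj] :
    2 * (c ⬝ᵥ fun v => (G.degree v : R)) = ∑ i, ∑ j, if G.Adj i j then c i + c j else 0 := by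
  have hleft : (c ⬝ᵥ fun v => (G.degree v : R)) = ∑ i, ∑ j, if G.Adj i j then c i else 0 := by
    simp only [dotProduct, SimpleGraph.degree_eq_sum_if_adj, Finset.mul_sum, mul_ite, mul_one,
      mul_zero]
  have hright : (c ⬝ᵥ fun v => (G.degree v : R)) = ∑ i, ∑ j, if G.Adj i j then c j else 0 := by
    rw [hleft, Finset.sum_comm]
    simp only [G.adj_comm]
  rw [two_mul]
  nth_rw 1 [hleft]
  simp only [hright, ← Finset.sum_add_distrib, ← ite_add_zero]

theorem dotProduct_degree_le_thresholdGraph [Semiring R] [LinearOrder R] [IsStrictOrderedRing R]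
    (c : V → R) (G : SimpleGraph V) [DecidableRel G.Adj] [DecidableRel (thresholdGraph c).Adj] :
    (c ⬝ᵥ fun v => (G.degree v : R)) ≤ c ⬝ᵥ fun v => ((thresholdGraph c).degree v : R) := by
  refine le_of_mul_le_mul_left ?_ (zero_lt_two' R)
  rw [two_mul_dotProduct_degree, two_mul_dotProduct_degree]
  refine Finset.sum_le_sum fun i _ => Finset.sum_le_sum fun j _ => ?_
  split_ifs with hG hT hT
  · exact le_rfl
  · exact not_lt.1 fun hpos => hT ⟨hG.ne, hpos⟩
  · exact hT.2.le
  · exact le_rfl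

end ThresholdGraphs

section AsymmetricPart

variable {n : ℕ}

theorem degreeSequence_apply (G : SimpleGraph (Fin n)) (i : Fin n) [Fintype (G.neighborSet i)] :
    degreeSequence G i = G.degree i := by
  rw [degreeSequence]
  congr!

theorem degreeSequence_comp_perm (G : SimpleGraph (Fin n)) (σ : Equiv.Perm (Fin n)) :
    degreeSequence G ∘ σ = degreeSequence (G.comap σ) := by
  classical
  ext i
  rw [Function.comp_apply, degreeSequence_apply, degreeSequence_apply,
    ← (SimpleGraph.Iso.comap σ G).degree_eq i, SimpleGraph.Iso.comap_apply]

theorem finite_degreeSequences : (degreeSequences n).Finite :=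
  (Set.finite_range (degreeSequence (n := n))).subset fun _ ⟨G, hG⟩ => ⟨G, hG.symm⟩

theorem degreePartitions_eq_inter : degreePartitions n = degreeSequences n ∩ antitoneCone (Fin n) :=
  Set.Subset.antisymm (fun _ ⟨hd, G, σ, h⟩ => ⟨⟨_, h.trans (degreeSequence_comp_perm G σ)⟩, hd⟩)
    fun _ ⟨⟨G, h⟩, hd⟩ => ⟨hd, G, Equiv.refl _, h⟩

theorem degreeSequence_thresholdGraph_le_of_le {c : Fin n → ℝ} {i j : Fin n} (h : c j ≤ c i) :
    degreeSequence (thresholdGraph c) j ≤ degreeSequence (thresholdGraph c) i := by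
  classical
  simpa only [degreeSequence_apply, Nat.cast_le] using degree_thresholdGraph_le_of_le h

theorem DP_eq_asymmetricPart : DP n = asymmetricPart (DS n) := by
  rw [DP, degreePartitions_eq_inter]
  refine (convexHull_inter_properCone
    ((finite_degreeSequences.inter_of_left _).isClosed_convexHull ℝ) fun p hp => ?_).symm
  have hanti : Antitone (degreeSequence (thresholdGraph p)) := fun i j hij =>
    degreeSequence_thresholdGraph_le_of_le (hp hij)
  have hmax : ∀ x ∈ degreeSequences n, p ⬝ᵥ x ≤ p ⬝ᵥ degreeSequence (thresholdGraph p) := by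
    classical
    rintro _ ⟨G, rfl⟩
    exact dotProduct_degree_le_thresholdGraph p G
  refine ⟨degreeSequence (thresholdGraph p), ⟨⟨_, rfl⟩, hanti⟩, hmax,
    exists_pos_sub_smul_mem_antitoneCone hp fun i j h => ?_⟩
  exact (degreeSequence_thresholdGraph_le_of_le h.le).antisymm
    (degreeSequence_thresholdGraph_le_of_le h.ge)

theorem DP_eq_latticeAsymmetricPart : DP n = latticeAsymmetricPart (DS n) := by
  refine Set.Subset.antisymm (convexHull_mono ?_) (convexHull_min ?_ (convex_convexHull ℝ _))
  · rw [degreePartitions_eq_inter]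
    rintro _ ⟨⟨G, rfl⟩, hanti⟩
    exact ⟨subset_convexHull ℝ _ ⟨G, rfl⟩, ⟨_, rfl⟩, hanti⟩
  · rintro x ⟨hx, -, hanti⟩
    exact DP_eq_asymmetricPart.ge ⟨hx, hanti⟩

end AsymmetricPart

section Volume

theorem smul_convexHull {M 𝕜 E : Type*} [Semiring 𝕜] [PartialOrder 𝕜] [AddCommMonoid E]
    [Module 𝕜 E] [DistribSMul M E] [SMulCommClass M 𝕜 E] (a : M) (s : Set E) :
    a • convexHull 𝕜 s = convexHull 𝕜 (a • s) :=
  (DistribSMul.toLinearMap 𝕜 E a).image_convexHull s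

theorem measure_setOf_apply_eq_apply {ι : Type*} [Finite ι] (μ : Measure (ι → ℝ))
    [μ.IsAddHaarMeasure] {i j : ι} (hij : i ≠ j) : μ {x | x i = x j} = 0 := by
  classical
  cases nonempty_fintype ι
  let f : (ι → ℝ) →ₗ[ℝ] ℝ := LinearMap.proj (R := ℝ) (φ := fun _ => ℝ) i - LinearMap.proj j
  have hker : {x : ι → ℝ | x i = x j} = f.ker := by
    ext x
    simp [f, sub_eq_zero]
  rw [hker]
  refine Measure.addHaar_submodule μ _ fun htop => ?_
  have hf : f (Pi.single i 1) = 0 := LinearMap.congr_fun (LinearMap.ker_eq_top.1 htop) _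
  simp [f, hij.symm] at hf

theorem ae_injective {ι : Type*} [Finite ι] (μ : Measure (ι → ℝ)) [μ.IsAddHaarMeasure] :
    ∀ᵐ x ∂μ, Function.Injective x := by
  have hne : ∀ᵐ x ∂μ, ∀ i j, i ≠ j → x i ≠ x j := by
    simp only [ae_all_iff]
    exact fun i j hij => by simpa [ae_iff] using measure_setOf_apply_eq_apply μ hij
  filter_upwards [hne] with x hx i j hij
  exact not_imp_not.1 (hx i j) hij

instance measurableConstSMul_domMulAct {M ι β : Type*} [SMul M ι] [MeasurableSpace β] :
    MeasurableConstSMul Mᵈᵐᵃ (ι → β) where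
  measurable_const_smul g := measurable_pi_lambda _ fun i =>
    measurable_pi_apply (DomMulAct.mk.symm g • i)

instance smulInvariantMeasure_domMulAct {G ι β : Type*} [Group G] [MulAction G ι] [Fintype ι]
    [MeasureSpace β] [SigmaFinite (volume : Measure β)] :
    SMulInvariantMeasure Gᵈᵐᵃ (ι → β) volume := by
  refine ((smulInvariantMeasure_tfae Gᵈᵐᵃ volume).out 0 6).2 fun g => ?_
  exact volume_preserving_arrowCongr' (MulAction.toPerm (DomMulAct.mk.symm g)).symm
    (MeasurableEquiv.refl β) (.id volume)

variable {n : ℕ}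

theorem isFundamentalDomain_setOf_antitone :
    IsFundamentalDomain (Equiv.Perm (Fin n))ᵈᵐᵃ {x : Fin n → ℝ | Antitone x} where
  nullMeasurableSet := isClosed_antitone.measurableSet.nullMeasurableSet
  ae_covers := .of_forall fun x => ⟨DomMulAct.mk (Tuple.sort (-x)), fun _ _ hij =>
    neg_le_neg_iff.1 (Tuple.monotone_sort (-x) hij)⟩
  aedisjoint g h hgh := by
    refine measure_mono_null ?_ (ae_iff.1 (ae_injective (volume : Measure (Fin n → ℝ))))
    rintro x ⟨hgx, hhx⟩ hinj
    rw [Set.mem_smul_set_iff_inv_smul_mem] at hgx hhx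
    have heq : g⁻¹ • x = h⁻¹ • x := Tuple.unique_antitone hgx hhx
    exact hgh (inv_injective (DomMulAct.mk.symm.injective
      (Equiv.ext fun i => hinj (congrFun heq i))))

theorem volume_eq_factorial_mul_volume_asymmetricPart {P : Set (Fin n → ℝ)}
    (hP : ∀ σ : (Equiv.Perm (Fin n))ᵈᵐᵃ, σ • P = P) :
    volume P = (n.factorial : ENNReal) * volume (asymmetricPart P) := by
  have : Finite (Equiv.Perm (Fin n))ᵈᵐᵃ := .of_equiv _ DomMulAct.mk
  have h := isFundamentalDomain_setOf_antitone.measure_eq_card_smul_of_smul_ae_eq_self P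
    fun σ => (hP σ).eventuallyEq
  rwa [Nat.card_congr DomMulAct.mk.symm, Nat.card_perm, Nat.card_fin, nsmul_eq_mul] at h

theorem smul_DS (σ : (Equiv.Perm (Fin n))ᵈᵐᵃ) : σ • DS n = DS n := by
  have hle : ∀ τ : (Equiv.Perm (Fin n))ᵈᵐᵃ, τ • degreeSequences n ⊆ degreeSequences n := by
    rintro τ _ ⟨_, ⟨G, rfl⟩, rfl⟩
    exact ⟨_, degreeSequence_comp_perm G (DomMulAct.mk.symm τ)⟩
  rw [DS, smul_convexHull]
  congr 1
  exact (hle σ).antisymm (Set.subset_smul_set_iff.2 (hle σ⁻¹))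

theorem volume_DS_eq_factorial_mul_volume_DP :
    volume (DS n) = (n.factorial : ENNReal) * volume (DP n) := by
  rw [DP_eq_asymmetricPart, volume_eq_factorial_mul_volume_asymmetricPart smul_DS]

end Volume

section Dimension

theorem submodule_eq_top_of_single_add_single_mem {ι K : Type*} [Fintype ι] [DecidableEq ι]
    [Field K] [NeZero (2 : K)] (hι : 3 ≤ Fintype.card ι) {W : Submodule K (ι → K)}
    (hW : ∀ i j, i ≠ j → (Pi.single i 1 + Pi.single j 1 : ι → K) ∈ W) : W = ⊤ := by
  have hsingle : ∀ i, (Pi.single i 1 : ι → K) ∈ W := by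
    intro i
    obtain ⟨j, hj, k, hk, hjk⟩ : ∃ j ∈ Finset.univ.erase i, ∃ k ∈ Finset.univ.erase i, j ≠ k :=
      Finset.one_lt_card.1 <| by
        rw [Finset.card_erase_of_mem (Finset.mem_univ i), Finset.card_univ]
        omega
    have htwo : (2 : K) • (Pi.single i 1 : ι → K) ∈ W := by
      convert W.sub_mem (W.add_mem (hW i j (Finset.ne_of_mem_erase hj).symm)
        (hW i k (Finset.ne_of_mem_erase hk).symm)) (hW j k hjk) using 1
      module
    exact (W.smul_mem_iff two_ne_zero).1 htwo
  rw [eq_top_iff, ← (Pi.basisFun K ι).span_eq, Submodule.span_le]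
  rintro _ ⟨i, rfl⟩
  simpa using hsingle i

theorem affineSpan_eq_top_iff_measure_ne_zero {E : Type*} [NormedAddCommGroup E] [NormedSpace ℝ E]
    [FiniteDimensional ℝ E] [MeasurableSpace E] [BorelSpace E] (μ : Measure E)
    [μ.IsAddHaarMeasure] {s : Set E} (hs : Convex ℝ s) : affineSpan ℝ s = ⊤ ↔ μ s ≠ 0 := by
  refine ⟨fun h => ?_, fun h => ?_⟩
  · exact (Measure.measure_pos_of_nonempty_interior μ
      (hs.interior_nonempty_iff_affineSpan_eq_top.2 h)).ne'
  · contrapose! h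
    exact measure_mono_null (subset_affineSpan ℝ s) (Measure.addHaar_affineSubspace μ _ h)

variable {n : ℕ}

theorem degreeSequence_bot : degreeSequence (⊥ : SimpleGraph (Fin n)) = 0 := by
  classical
  ext i
  simp [degreeSequence_apply]

theorem degreeSequence_edge {i j : Fin n} (hij : i ≠ j) :
    degreeSequence (SimpleGraph.edge i j) = Pi.single i 1 + Pi.single j 1 := by
  classical
  ext k
  have hadj : ∀ l, (if (SimpleGraph.edge i j).Adj k l then (1 : ℝ) else 0)
      = (if k = i then if l = j then 1 else 0 else 0)
        + if k = j then if l = i then 1 else 0 else 0 := by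
    intro l
    simp only [SimpleGraph.edge_adj]
    grind
  simp only [degreeSequence_apply, SimpleGraph.degree_eq_sum_if_adj, hadj, Finset.sum_add_distrib,
    Finset.sum_ite_irrel, Finset.sum_ite_eq', Finset.mem_univ, if_true, Finset.sum_const_zero,
    Pi.add_apply, Pi.single_apply]

theorem affineSpan_DS_eq_top (hn : 3 ≤ n) : affineSpan ℝ (DS n) = ⊤ := by
  have hzero : 0 ∈ degreeSequences n := ⟨⊥, degreeSequence_bot.symm⟩
  rw [DS, affineSpan_convexHull,
    AffineSubspace.affineSpan_eq_top_iff_vectorSpan_eq_top_of_nonempty ℝ _ _ ⟨0, hzero⟩]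
  refine submodule_eq_top_of_single_add_single_mem (by simpa using hn) fun i j hij => ?_
  have hedge : Pi.single i 1 + Pi.single j 1 ∈ degreeSequences n :=
    ⟨SimpleGraph.edge i j, (degreeSequence_edge hij).symm⟩
  simpa using vsub_mem_vectorSpan ℝ hedge hzero

theorem affineSpan_DP_eq_top (hn : 3 ≤ n) : affineSpan ℝ (DP n) = ⊤ := by
  have hDS : volume (DS n) ≠ 0 :=
    (affineSpan_eq_top_iff_measure_ne_zero volume (convex_convexHull ℝ _)).1
      (affineSpan_DS_eq_top hn)
  rw [volume_DS_eq_factorial_mul_volume_DP] at hDS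
  exact (affineSpan_eq_top_iff_measure_ne_zero volume (convex_convexHull ℝ _)).2
    (right_ne_zero_of_mul hDS)

theorem dim_eq_of_affineSpan_eq_top {P : Set (Fin n → ℝ)} (h : affineSpan ℝ P = ⊤) :
    dim P = n := by
  rw [dim, h, AffineSubspace.direction_top, finrank_top, Module.finrank_fin_fun]

end Dimension

end DegreePolytopes

theorem mainTheorem2 (n : ℕ) (hn : 3 ≤ n) :
    MeasureTheory.volume (DegreePolytopes.DS n)
        = (Nat.factorial n : ENNReal) * MeasureTheory.volume (DegreePolytopes.DP n) ∧
      DegreePolytopes.DP n = DegreePolytopes.asymmetricPart (DegreePolytopes.DS n) ∧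
      DegreePolytopes.DP n = DegreePolytopes.latticeAsymmetricPart (DegreePolytopes.DS n) ∧
      DegreePolytopes.dim (DegreePolytopes.DS n) = n ∧
      DegreePolytopes.dim (DegreePolytopes.DP n) = n :=
  ⟨DegreePolytopes.volume_DS_eq_factorial_mul_volume_DP,
    DegreePolytopes.DP_eq_asymmetricPart,
    DegreePolytopes.DP_eq_latticeAsymmetricPart,
    DegreePolytopes.dim_eq_of_affineSpan_eq_top (DegreePolytopes.affineSpan_DS_eq_top hn),
    DegreePolytopes.dim_eq_of_affineSpan_eq_top (DegreePolytopes.affineSpan_DP_eq_top hn)⟩
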